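/- **Proposition 7.3 (Generalized Weyl character formula).** *Parameters.* Let $q,k_0,k_1,u_0,u_1$ be non-zero complex numbers, fix a square root $q^{1/2}$ of $q$, and write $\underline t=(k_0,k_1,u_0,u_1)$. Assume that $|q|\neq 1$, that $k_0^2,k_1^2,u_1^2\notin\pm q^{\mathbb Z}$, and that $k_0^2k_1^2\notin\{q^{-1},q^{-2},q^{-3},\dots\}$. Put $a=k_1u_1$ and $b=-k_1u_1^{-1}$. *Operators.* On $\mathcal A=\mathbb C[x,x^{-1}]$ let $(s_0f)(x)=f(qx^{-1})$, $(s_1f)(x)=f(x^{-1})$, $$T_0=k_0+k_0^{-1}\frac{(1-k_0u_0q^{1/2}x^{-1})(1+k_0u_0^{-1}q^{1/2}x^{-1})}{1-qx^{-2}}(s_0-1),\qquad T_1=k_1+k_1^{-1}\frac{(1-k_1u_1x)(1+k_1u_1^{-1}x)}{1-x^2}(s_1-1),$$ and $Y=T_1T_0$. These are linear endomorphisms of $\mathcal A$. Put $\gamma_m=k_0k_1q^m$ for integers $m\ge 0$ and $\gamma_m=k_0^{-1}k_1^{-1}q^m$ for integers $m<0$. "Lower order terms" refers to the total order $1\prec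 x^{-1}\prec x\prec x^{-2}\prec x^2\prec\cdots$ on monomials. *Askey–Wilson polynomials.* For $m\in\mathbb Z$ let $P_m=P_m(\cdot\,;\underline t;q)\in\mathcal A$ be the unique Laurent polynomial of the form $x^m+$ lower order terms with $YP_m=\gamma_mP_m$. For $m\ge 0$ let $\mathcal A(m)=\operatorname{span}\{P_m,P_{-m}\}$, and let $$C_+=\frac{1}{1+k_1^2}(1+k_1T_1),\qquad C_-=\frac{1}{1+k_1^{-2}}(1-k_1^{-1}T_1).$$ Let $P_m^+=P_m^+(\cdot\,;\underline t;q)$ ($m\ge 0$) be the unique element of $C_+\mathcal A(m)$ of the form $x^m+$ lower order terms, and let $P_m^-=P_m^-(\cdot\,;\underline t;q)$ ($m\ge 1$) be the unique element of $C_-\mathcal A(m)$ of the form $x^m+$ lower order terms. *Claim.* Let $m\ge 1$. The polynomials $P_n(\cdot\,;\underline t;q)$ and $P_n(\cdot\,;k_0,qk_1,u_0,u_1;q)$ ($n\in\mathbb Z$), as well as $P_m^-(\cdot\,;\underline t;q)$ and $P_{m-1}^+(\cdot\,;k_0,qk_1,u_0,u_1;q)$, exist and are unique, and $$P_m^-(x;\underline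 t;q)=\delta(x)\,P_{m-1}^+(x;k_0,qk_1,u_0,u_1;q),\qquad \delta(x)=x^{-1}(x-a^{-1})(x-b^{-1}).$$ -/

import Mathlib

open scoped LaurentPolynomial

namespace AskeyWilson

noncomputable section

/-- The algebra of Laurent polynomials in one indeterminate `x`; the monomial `x ^ m` is
`LaurentPolynomial.T m`. -/
abbrev Laurent : Type := ℂ[T;T⁻¹]

/-- The parameters: a non-zero deformation parameter `q`, together with the square root
`q ^ (1 / 2)` that enters through the affine root `a₀ / 2` (any of the two square roots may be
taken), and a multiplicity function, that is, four non-zero complex numbers, the values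
`k₀ = t (a₀)`, `k₁ = t (a₁)`, `u₀ = t (a₀ / 2)`, `u₁ = t (a₁ / 2)`. -/
structure Params where
  /-- the chosen square root of `q` -/
  sqrtq : ℂ
  k0 : ℂ
  k1 : ℂ
  u0 : ℂ
  u1 : ℂ
  sqrtq_ne : sqrtq ≠ 0
  k0_ne : k0 ≠ 0
  k1_ne : k1 ≠ 0
  u0_ne : u0 ≠ 0
  u1_ne : u1 ≠ 0

/-! ### Reflections and divided differences

An affine root `a` with `x ^ (a / 2) = h x ^ e`, where `e = 1` or `e = -1`, acts on Laurent
polynomials by the reflection `s_a (x ^ m) = x ^ (m - ⟨m, a^∨⟩ a)`, where `⟨m, a^∨⟩ = e m`. -/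

/-- The linear map that sends `x ^ m` to `φ m` for every integer `m`. -/
def ofMonomials (φ : ℤ → Laurent) : Laurent →ₗ[ℂ] Laurent :=
  (Finsupp.linearCombination ℂ φ).comp (AddMonoidAlgebra.coeffLinearEquiv ℂ).toLinearMap

/-- The monomial `x ^ (j a)` for the root `a` with `x ^ (a / 2) = h x ^ e`. -/
def rootMonomial (h : ℂ) (e j : ℤ) : Laurent :=
  (h ^ (2 * j)) • LaurentPolynomial.T (2 * e * j)

/-- The reflection `s_a`, with `s_a (x ^ m) = x ^ (m - e m a)`. -/
def reflection (h : ℂ) (e : ℤ) : Laurent →ₗ[ℂ] Laurent :=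
  ofMonomials fun m => LaurentPolynomial.T m * rootMonomial h e (-(e * m))

/-- The divided difference `D_a f = (f - s_a f) / (1 - x ^ a)`, given on monomials; see
`one_sub_mul_dividedDifference`. -/
def dividedDifference (h : ℂ) (e : ℤ) : Laurent →ₗ[ℂ] Laurent :=
  ofMonomials fun m =>
    if 0 < e * m then
      -∑ j ∈ Finset.range (e * m).toNat, LaurentPolynomial.T m * rootMonomial h e (-(j + 1 : ℤ))
    else
      ∑ j ∈ Finset.range (-(e * m)).toNat, LaurentPolynomial.T m * rootMonomial h e j

/-- The difference-reflection operator
`k + k⁻¹ (1 - k u x ^ (a / 2)) (1 + k u⁻¹ x ^ (a / 2)) / (1 - x ^ a) (s_a - 1)`. -/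
def heckeOperator (h : ℂ) (e : ℤ) (k u : ℂ) : Laurent →ₗ[ℂ] Laurent :=
  k • LinearMap.id - k⁻¹ •
    (LinearMap.mulLeft ℂ
      ((1 - (k * u * h) • LaurentPolynomial.T e) *
        (1 + (k * u⁻¹ * h) • LaurentPolynomial.T e))).comp (dividedDifference h e)

theorem ofMonomials_T (φ : ℤ → Laurent) (m : ℤ) :
    ofMonomials φ (LaurentPolynomial.T m) = φ m := by
  change Finsupp.linearCombination ℂ φ (Finsupp.single m (1 : ℂ)) = φ m
  rw [Finsupp.linearCombination_single, one_smul]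

theorem rootMonomial_add {h : ℂ} (hh : h ≠ 0) (e i j : ℤ) :
    rootMonomial h e (i + j) = rootMonomial h e i * rootMonomial h e j := by
  simp only [rootMonomial, mul_add, zpow_add₀ hh, LaurentPolynomial.T_add, smul_mul_smul_comm]

theorem rootMonomial_zero (h : ℂ) (e : ℤ) : rootMonomial h e 0 = 1 := by
  simp [rootMonomial]

theorem one_sub_mul_dividedDifference {h : ℂ} (hh : h ≠ 0) (e : ℤ) (f : Laurent) :
    (1 - rootMonomial h e 1) * dividedDifference h e f = f - reflection h e f := by
  have key : ∀ (M : Laurent) (n : ℕ), (1 - rootMonomial h e 1) *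
      ∑ j ∈ Finset.range n, M * rootMonomial h e j = M - M * rootMonomial h e n := by
    intro M n
    induction n with
    | zero => simp [rootMonomial_zero]
    | succ n ih =>
      rw [Finset.sum_range_succ, mul_add, ih]
      push_cast
      rw [rootMonomial_add hh]
      ring
  have key' : ∀ (M : Laurent) (n : ℕ), (1 - rootMonomial h e 1) *
      -∑ j ∈ Finset.range n, M * rootMonomial h e (-(j + 1 : ℤ)) =
        M - M * rootMonomial h e (-(n : ℤ)) := by
    intro M n
    induction n with
    | zero => simp [rootMonomial_zero]
    | succ n ih =>
      have h1 : rootMonomial h e (-(n : ℤ)) =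
          rootMonomial h e 1 * rootMonomial h e (-(n + 1 : ℤ)) := by
        rw [← rootMonomial_add hh]
        congr 1
        ring
      rw [Finset.sum_range_succ, neg_add, mul_add, ih, h1]
      push_cast
      ring
  have hlin : (LinearMap.mulLeft ℂ (1 - rootMonomial h e 1)).comp (dividedDifference h e) =
      LinearMap.id - reflection h e := by
    apply AddMonoidAlgebra.lhom_ext'
    intro m
    apply LinearMap.ext_ring
    change (1 - rootMonomial h e 1) * dividedDifference h e (LaurentPolynomial.T m) =
      LaurentPolynomial.T m - reflection h e (LaurentPolynomial.T m)
    rw [dividedDifference, reflection, ofMonomials_T, ofMonomials_T]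
    split_ifs with hm
    · rw [key', Int.toNat_of_nonneg hm.le]
    · rw [key, Int.toNat_of_nonneg (by omega)]
  exact LinearMap.congr_fun hlin f

/-- `s₀ (x ^ m) = q ^ m x ^ (-m)`. -/
theorem reflection_zero_T (h : ℂ) (m : ℤ) :
    reflection h (-1) (LaurentPolynomial.T m) = ((h ^ 2) ^ m) • LaurentPolynomial.T (-m) := by
  rw [reflection, ofMonomials_T, rootMonomial, mul_smul_comm, ← LaurentPolynomial.T_add, zpow_mul]
  congr 2
  · simp only [neg_mul, one_mul, neg_neg]
  · ring

/-- `s₁ (x ^ m) = x ^ (-m)`. -/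
theorem reflection_one_T (m : ℤ) :
    reflection 1 1 (LaurentPolynomial.T m) = LaurentPolynomial.T (-m) := by
  rw [reflection, ofMonomials_T, rootMonomial, one_zpow, one_smul, ← LaurentPolynomial.T_add]
  congr 1
  ring

/-! ### The total order on monomials -/

/-- The strict total order `1 ≺ x⁻¹ ≺ x ≺ x⁻² ≺ x² ≺ ⋯` on monomials, in terms of exponents. -/
def MonomialLT (m n : ℤ) : Prop :=
  |m| < |n| ∨ |m| = |n| ∧ m < n

/-- `f = x ^ m +` lower order terms. -/
def MonicOfDegree (m : ℤ) (f : Laurent) : Prop :=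
  f.coeff m = 1 ∧ ∀ n : ℤ, f.coeff n ≠ 0 → n = m ∨ MonomialLT n m

namespace Params

variable (t : Params)

/-- The deformation parameter. -/
def q : ℂ := t.sqrtq ^ 2

theorem q_ne : t.q ≠ 0 := pow_ne_zero 2 t.sqrtq_ne

/-- The multiplicity function `(k₀, q k₁, u₀, u₁)`, with the same `q`. -/
def shift : Params :=
  { t with
    k1 := t.q * t.k1
    k1_ne := mul_ne_zero t.q_ne t.k1_ne }

/-- The genericity conditions: `|q| ≠ 1`, none of `k₀²`, `k₁²`, `u₁²` lies in `± q ^ ℤ`, and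
`k₀² k₁²` is not one of `q⁻¹, q⁻², …`, so that the eigenvalues `γ_m` are pairwise different. -/
structure Generic : Prop where
  norm_q : ‖t.q‖ ≠ 1
  k0_sq : ∀ n : ℤ, t.k0 ^ 2 ≠ t.q ^ n ∧ t.k0 ^ 2 ≠ -t.q ^ n
  k1_sq : ∀ n : ℤ, t.k1 ^ 2 ≠ t.q ^ n ∧ t.k1 ^ 2 ≠ -t.q ^ n
  u1_sq : ∀ n : ℤ, t.u1 ^ 2 ≠ t.q ^ n ∧ t.u1 ^ 2 ≠ -t.q ^ n
  k0_k1_sq : ∀ n : ℤ, n < 0 → t.k0 ^ 2 * t.k1 ^ 2 ≠ t.q ^ n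

/-- `T₀`, for the root `a₀` with `x ^ (a₀ / 2) = q ^ (1 / 2) x⁻¹` and `x ^ a₀ = q x⁻²`. -/
def T0 : Laurent →ₗ[ℂ] Laurent := heckeOperator t.sqrtq (-1) t.k0 t.u0

/-- `T₁`, for the root `a₁` with `x ^ (a₁ / 2) = x` and `x ^ a₁ = x²`. -/
def T1 : Laurent →ₗ[ℂ] Laurent := heckeOperator 1 1 t.k1 t.u1

/-- The Cherednik-Dunkl operator `Y = T₁ T₀`. -/
def Y : Laurent →ₗ[ℂ] Laurent := t.T1.comp t.T0

/-- `γ_m = k₀ ^ ε(m) k₁ ^ ε(m) q ^ m`, where `ε(m) = 1` if `m ≥ 0` and `ε(m) = -1` if `m < 0`. -/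
def γ (m : ℤ) : ℂ :=
  if 0 ≤ m then t.k0 * t.k1 * t.q ^ m else t.k0⁻¹ * t.k1⁻¹ * t.q ^ m

/-- `f` is the monic, non-symmetric Askey-Wilson polynomial of degree `m`. -/
def IsNonsymmetricAW (m : ℤ) (f : Laurent) : Prop :=
  MonicOfDegree m f ∧ t.Y f = t.γ m • f

/-- The monic, non-symmetric Askey-Wilson polynomial `P_m`. -/
def nonsymmetricAW (m : ℤ) : Laurent :=
  Classical.epsilon (t.IsNonsymmetricAW m)

/-- The idempotent `C₊ = (1 + k₁²)⁻¹ (1 + k₁ T₁)` acting on Laurent polynomials. -/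
def Cplus : Laurent →ₗ[ℂ] Laurent :=
  (1 + t.k1 ^ 2)⁻¹ • (LinearMap.id + t.k1 • t.T1)

/-- The idempotent `C₋ = (1 + k₁⁻²)⁻¹ (1 - k₁⁻¹ T₁)` acting on Laurent polynomials. -/
def Cminus : Laurent →ₗ[ℂ] Laurent :=
  (1 + (t.k1 ^ 2)⁻¹)⁻¹ • (LinearMap.id - t.k1⁻¹ • t.T1)

/-- The space `𝒜(m)` spanned by `P_m` and `P_{-m}`. -/
def component (m : ℕ) : Submodule ℂ Laurent :=
  Submodule.span ℂ {t.nonsymmetricAW m, t.nonsymmetricAW (-(m : ℤ))}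

/-- `f ∈ C₊ 𝒜(m)` is of the form `x ^ m +` lower order terms. -/
def IsSymmetricAW (m : ℕ) (f : Laurent) : Prop :=
  f ∈ (t.component m).map t.Cplus ∧ MonicOfDegree m f

/-- `f ∈ C₋ 𝒜(m)` is of the form `x ^ m +` lower order terms. -/
def IsAntisymmetricAW (m : ℕ) (f : Laurent) : Prop :=
  f ∈ (t.component m).map t.Cminus ∧ MonicOfDegree m f

/-- The monic, symmetric Askey-Wilson polynomial `P_m⁺` (`m ≥ 0`). -/
def symmetricAW (m : ℕ) : Laurent :=
  Classical.epsilon (t.IsSymmetricAW m)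

/-- The monic, anti-symmetric Askey-Wilson polynomial `P_m⁻` (`m ≥ 1`). -/
def antisymmetricAW (m : ℕ) : Laurent :=
  Classical.epsilon (t.IsAntisymmetricAW m)

/-- The Askey-Wilson parameter `a = k₁ u₁`. -/
def a : ℂ := t.k1 * t.u1

/-- The Askey-Wilson parameter `b = -k₁ u₁⁻¹`. -/
def b : ℂ := -t.k1 * t.u1⁻¹

/-- The generalized Weyl denominator `δ(x) = x⁻¹ (x - a⁻¹) (x - b⁻¹)`. -/
def weylDenominator : Laurent :=
  LaurentPolynomial.T (-1) *
    (LaurentPolynomial.T 1 - LaurentPolynomial.C t.a⁻¹) *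
    (LaurentPolynomial.T 1 - LaurentPolynomial.C t.b⁻¹)

end Params

end

end AskeyWilson

namespace AskeyWilson

noncomputable section

/-! Both sides are characterized by eigenvalue equations, and multiplication by `δ` carries one set
of equations to the other. The operator `D = Y + Y⁻¹` commutes with `T₁` (`D_T1`), and for `m ≥ 1`
the space `𝒜(m)` is its full eigenspace for `γ_m + γ_m⁻¹` (`D_of_mem_component`,
`mem_component_of_D`). Hence `𝒜(m)` is stable under `T₁`, and `C₊ 𝒜(m)`, `C₋ 𝒜(m)` are the
eigenspaces of `T₁` on it for `k₁` and `-k₁⁻¹` (`mem_map_Cplus`, `mem_map_Cminus`).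

Let `g` be the symmetric polynomial of degree `m - 1` for the parameters with `q k₁`. It is
invariant under `x ↦ x⁻¹`, so `δ g` has `T₁`-eigenvalue `-k₁⁻¹` (`T1_weylDenominator_mul`). On such
`g`, multiplication by `δ` intertwines the shifted and the original `D` (`D_weylDenominator_mul`),
and the eigenvalues match because `γ_{m-1}` for `q k₁` is `γ_m` for `k₁` (`γ_shift`). So `δ g` is a
monic element of `C₋ 𝒜(m)`, and there is only one (`T1_eigenvector_unique`).

The operator identities are checked as identities of rational functions, at points off the poles
(`ext_of_eval`). Existence and uniqueness of the `P_n` come from the triangularity of `Y` with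
pairwise different diagonal entries (`Y_triangular`, `γ_injective`). -/

/-! ### Evaluation of Laurent polynomials -/

/-- Evaluation of Laurent polynomials at a point; it is multiplicative at non-zero points. -/
def eval (x : ℂ) : Laurent →ₗ[ℂ] ℂ :=
  (Finsupp.linearCombination ℂ fun n : ℤ => x ^ n).comp
    (AddMonoidAlgebra.coeffLinearEquiv ℂ).toLinearMap

@[simp]
theorem eval_T (x : ℂ) (m : ℤ) : eval x (LaurentPolynomial.T m) = x ^ m := by
  change Finsupp.linearCombination ℂ _ (Finsupp.single m (1 : ℂ)) = _
  rw [Finsupp.linearCombination_single, one_smul]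

@[simp]
theorem eval_one (x : ℂ) : eval x 1 = 1 := by
  simpa using eval_T x 0

@[simp]
theorem eval_C (x c : ℂ) : eval x (LaurentPolynomial.C c) = c := by
  rw [← mul_one (LaurentPolynomial.C c), ← LaurentPolynomial.smul_eq_C_mul, map_smul, eval_one,
    smul_eq_mul, mul_one]

/-- Linear maps on Laurent polynomials that agree on monomials are equal. -/
theorem linearMap_ext {M : Type*} [AddCommMonoid M] [Module ℂ M] {φ ψ : Laurent →ₗ[ℂ] M}
    (h : ∀ m : ℤ, φ (LaurentPolynomial.T m) = ψ (LaurentPolynomial.T m)) : φ = ψ := by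
  apply AddMonoidAlgebra.lhom_ext'
  intro m
  apply LinearMap.ext_ring
  exact h m

theorem eval_mul {x : ℂ} (hx : x ≠ 0) (f g : Laurent) : eval x (f * g) = eval x f * eval x g := by
  have h : (LinearMap.mul ℂ Laurent).compr₂ (eval x) =
      (LinearMap.mul ℂ ℂ).compl₁₂ (eval x) (eval x) := by
    apply linearMap_ext
    intro m
    apply linearMap_ext
    intro n
    simp only [LinearMap.compr₂_apply, LinearMap.mul_apply', LinearMap.compl₁₂_apply,
      ← LaurentPolynomial.T_add, eval_T, zpow_add₀ hx]
  exact LinearMap.congr_fun₂ h f g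

theorem eval_toLaurent {x : ℂ} (hx : x ≠ 0) (p : Polynomial ℂ) :
    eval x (Polynomial.toLaurent p) = p.eval x := by
  induction p using Polynomial.induction_on' with
  | add p q hp hq => simp only [map_add, hp, hq, Polynomial.eval_add]
  | monomial n a =>
    rw [Polynomial.toLaurent_C_mul_T, eval_mul hx]
    simp

/-- Laurent polynomials that agree outside a finite set are equal. -/
theorem ext_of_eval (s : Finset ℂ) {f g : Laurent}
    (h : ∀ x : ℂ, x ≠ 0 → x ^ 2 ∉ s → eval x f = eval x g) : f = g := by
  rw [← sub_eq_zero]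
  -- A power of `x` turns the difference into an ordinary polynomial, which then has infinitely many
  -- roots.
  obtain ⟨n, p, hp⟩ := LaurentPolynomial.exists_T_pow (f - g)
  have hfin : {x : ℂ | x = 0 ∨ x ^ 2 ∈ s}.Finite := by
    refine (Set.finite_singleton (0 : ℂ)).union ?_
    refine s.finite_toSet.preimage' fun c _ => ?_
    refine (Polynomial.nthRoots 2 c).toFinset.finite_toSet.subset fun x hx => ?_
    simpa [Polynomial.mem_nthRoots] using hx
  have hp0 : p = 0 := by
    refine Polynomial.eq_zero_of_infinite_isRoot p (hfin.infinite_compl.mono fun x hx => ?_)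
    simp only [Set.mem_compl_iff, Set.mem_ofPred_eq, not_or] at hx
    change p.eval x = 0
    rw [← eval_toLaurent hx.1, hp, eval_mul hx.1, map_sub, h x hx.1 hx.2, sub_self, zero_mul]
  rw [hp0, map_zero] at hp
  exact (LaurentPolynomial.isUnit_T (R := ℂ) n).mul_left_eq_zero.mp hp.symm

/-- The hypothesis `e * e = 1` encodes `e = ±1` in a form usable by `linear_combination`. -/
theorem eval_reflection (h : ℂ) {e : ℤ} (he : e * e = 1) (x : ℂ) (f : Laurent) :
    eval x (reflection h e f) = eval (h ^ (-2 * e) * x⁻¹) f := by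
  have key : (eval x).comp (reflection h e) = eval (h ^ (-2 * e) * x⁻¹) := by
    apply linearMap_ext
    intro m
    have h1 : m + 2 * e * -(e * m) = -m := by linear_combination (-2 * m) * he
    rw [LinearMap.comp_apply, reflection, ofMonomials_T, rootMonomial, mul_smul_comm,
      ← LaurentPolynomial.T_add, h1, map_smul, eval_T, eval_T, mul_zpow, smul_eq_mul, inv_zpow,
      ← zpow_neg, ← zpow_mul]
    congr 2
    ring
  exact LinearMap.congr_fun key f

/-! ### Difference-reflection operators as operators on functions -/

theorem eval_heckeOperator {h : ℂ} (hh : h ≠ 0) {e : ℤ} (he : e * e = 1) (k u : ℂ) {x : ℂ}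
    (hx : x ≠ 0) (hy : (h * x ^ e) ^ 2 ≠ 1) (f : Laurent) :
    eval x (heckeOperator h e k u f) = k * eval x f +
      k⁻¹ * ((1 - k * u * (h * x ^ e)) * (1 + k * u⁻¹ * (h * x ^ e)) / (1 - (h * x ^ e) ^ 2)) *
        (eval (h ^ (-2 * e) * x⁻¹) f - eval x f) := by
  have h1 := congrArg (eval x) (one_sub_mul_dividedDifference hh e f)
  have h2 : eval x (rootMonomial h e 1) = (h * x ^ e) ^ 2 := by
    rw [rootMonomial, map_smul, eval_T, smul_eq_mul, mul_pow, ← zpow_natCast, ← zpow_natCast,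
      ← zpow_mul]
    congr 2
    push_cast
    ring
  rw [eval_mul hx, map_sub, map_sub, eval_one, eval_reflection h he x, h2] at h1
  have h3 : 1 - (h * x ^ e) ^ 2 ≠ 0 := sub_ne_zero.mpr hy.symm
  have h4 : eval x (dividedDifference h e f) =
      (eval x f - eval (h ^ (-2 * e) * x⁻¹) f) / (1 - (h * x ^ e) ^ 2) := by
    rw [eq_div_iff h3, ← h1, mul_comm]
  simp only [heckeOperator, LinearMap.sub_apply, LinearMap.smul_apply, LinearMap.id_apply,
    LinearMap.comp_apply, LinearMap.mulLeft_apply, map_sub, map_smul, smul_eq_mul, eval_mul hx,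
    map_add, eval_one, eval_T, h4]
  ring

/-- The quadratic Hecke relation. -/
theorem heckeOperator_heckeOperator {h : ℂ} (hh : h ≠ 0) {e : ℤ} (he : e * e = 1) {k u : ℂ}
    (hk : k ≠ 0) (hu : u ≠ 0) (f : Laurent) :
    heckeOperator h e k u (heckeOperator h e k u f) =
      (k - k⁻¹) • heckeOperator h e k u f + f := by
  -- The excluded points are the zeros of `1 - x ^ a`, which are the fixed points of the reflection.
  refine ext_of_eval {h ^ (-2 * e)} fun x hx hx2 => ?_
  have hx' : h ^ (-2 * e) * x⁻¹ ≠ 0 := mul_ne_zero (zpow_ne_zero _ hh) (inv_ne_zero hx)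
  have he' : e = 1 ∨ e = -1 := mul_self_eq_one_iff.mp he
  have hy0 : h * x ^ e ≠ 0 := mul_ne_zero hh (zpow_ne_zero _ hx)
  -- The reflection inverts `y = x ^ (a / 2)`, so everything becomes a rational identity in `y`.
  have hyy : h * (h ^ (-2 * e) * x⁻¹) ^ e = (h * x ^ e)⁻¹ := by
    rw [mul_zpow, ← zpow_mul, inv_zpow, mul_inv, ← mul_assoc,
      show -2 * e * e = -2 by linear_combination (-2) * he]
    congr 1
    rw [zpow_neg]
    field_simp
  have hy : (h * x ^ e) ^ 2 ≠ 1 := by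
    intro hc
    apply hx2
    rw [Finset.mem_singleton]
    rcases he' with rfl | rfl
    · simp only [zpow_one, mul_one, zpow_neg] at hc ⊢
      have : h ^ (2 : ℤ) = h ^ 2 := by norm_cast
      rw [this]
      field_simp
      linear_combination hc
    · simp only [zpow_neg, zpow_one, mul_neg, mul_one, neg_neg] at hc ⊢
      have : h ^ (2 : ℤ) = h ^ 2 := by norm_cast
      rw [this]
      field_simp at hc
      exact hc.symm
  have hy' : (h * (h ^ (-2 * e) * x⁻¹) ^ e) ^ 2 ≠ 1 := by
    rw [hyy, inv_pow]
    exact fun hc => hy (inv_eq_one.mp hc)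
  have hrr : h ^ (-2 * e) * (h ^ (-2 * e) * x⁻¹)⁻¹ = x := by
    have := zpow_ne_zero (-2 * e) hh
    field_simp
  simp only [map_add, map_smul, smul_eq_mul]
  rw [eval_heckeOperator hh he k u hx hy, eval_heckeOperator hh he k u hx hy,
    eval_heckeOperator hh he k u hx' hy', hyy, hrr]
  generalize h * x ^ e = y at *
  have h1 : 1 - y ^ 2 ≠ 0 := sub_ne_zero.mpr hy.symm
  have h2 : y ^ 2 - 1 ≠ 0 := sub_ne_zero.mpr hy
  have h3 : 1 - (y⁻¹) ^ 2 = (y ^ 2 - 1) / y ^ 2 := by field_simp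
  rw [h3, show y ^ 2 - 1 = -(1 - y ^ 2) by ring]
  field_simp
  ring

theorem heckeOperator_one {h : ℂ} {e : ℤ} (k u : ℂ) : heckeOperator h e k u 1 = k • 1 := by
  have : dividedDifference h e 1 = 0 := by
    rw [← LaurentPolynomial.T_zero, dividedDifference, ofMonomials_T]
    simp
  simp [heckeOperator, this]

/-- An eigenvector of the difference-reflection operator for the eigenvalue `k` is invariant under
the reflection. -/
theorem reflection_eq_of_heckeOperator_eq {h : ℂ} (hh : h ≠ 0) {e : ℤ} (he : e * e = 1) {k u : ℂ}
    (hk : k ≠ 0) {f : Laurent} (hf : heckeOperator h e k u f = k • f) : reflection h e f = f := by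
  have he0 : e ≠ 0 := by rintro rfl; simp at he
  -- Neither linear factor of the Hecke operator vanishes, so in the domain of Laurent polynomials
  -- the divided difference must.
  have hne : ∀ c : ℂ, (1 + c • LaurentPolynomial.T e : Laurent) ≠ 0 := by
    intro c hc
    have := congrArg (fun g : Laurent => g.coeff 0) hc
    simp [he0] at this
  simp only [heckeOperator, LinearMap.sub_apply, LinearMap.smul_apply, LinearMap.id_apply,
    LinearMap.comp_apply, LinearMap.mulLeft_apply, sub_eq_self, smul_eq_zero, inv_eq_zero, hk,
    false_or, mul_eq_zero, hne, or_false] at hf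
  have hD : dividedDifference h e f = 0 := by
    rcases hf with hf | hf
    · exact absurd hf (by simpa [sub_eq_add_neg] using hne (-(k * u * h)))
    · exact hf
  have := one_sub_mul_dividedDifference hh e f
  rw [hD, mul_zero] at this
  exact (sub_eq_zero.mp this.symm).symm

/-! ### The Hecke algebra relations, `Y + Y⁻¹`, and the Weyl denominator -/

namespace Params

variable (t : Params)

theorem eval_T0 {x : ℂ} (hx : x ≠ 0) (hq : x ^ 2 ≠ t.q) (f : Laurent) :
    eval x (t.T0 f) = t.k0 * eval x f +
      t.k0⁻¹ * ((1 - t.k0 * t.u0 * (t.sqrtq * x⁻¹)) * (1 + t.k0 * t.u0⁻¹ * (t.sqrtq * x⁻¹)) /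
        (1 - (t.sqrtq * x⁻¹) ^ 2)) * (eval (t.q * x⁻¹) f - eval x f) := by
  have hy : (t.sqrtq * x ^ (-1 : ℤ)) ^ 2 ≠ 1 := by
    intro hc
    rw [zpow_neg_one, mul_pow, inv_pow, mul_inv_eq_one₀ (pow_ne_zero 2 hx)] at hc
    exact hq hc.symm
  have h2 : t.sqrtq ^ (-2 * -1 : ℤ) = t.q := by
    rw [q, show (-2 * -1 : ℤ) = 2 by norm_num]
    norm_cast
  rw [T0, eval_heckeOperator t.sqrtq_ne (by norm_num) _ _ hx hy, h2, zpow_neg_one]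

theorem eval_T1 {x : ℂ} (hx : x ≠ 0) (hx1 : x ^ 2 ≠ 1) (f : Laurent) :
    eval x (t.T1 f) = t.k1 * eval x f +
      t.k1⁻¹ * ((1 - t.k1 * t.u1 * x) * (1 + t.k1 * t.u1⁻¹ * x) / (1 - x ^ 2)) *
        (eval x⁻¹ f - eval x f) := by
  have := eval_heckeOperator one_ne_zero (e := 1) (by norm_num) t.k1 t.u1 hx (by simpa using hx1) f
  simpa [T1] using this

theorem T1_T1 (f : Laurent) : t.T1 (t.T1 f) = (t.k1 - t.k1⁻¹) • t.T1 f + f :=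
  heckeOperator_heckeOperator one_ne_zero (by norm_num) t.k1_ne t.u1_ne f

theorem T0_T0 (f : Laurent) : t.T0 (t.T0 f) = (t.k0 - t.k0⁻¹) • t.T0 f + f :=
  heckeOperator_heckeOperator t.sqrtq_ne (by norm_num) t.k0_ne t.u0_ne f

/-- The inverse `T₀⁻¹ T₁⁻¹` of `Y`. -/
def Yinv : Laurent →ₗ[ℂ] Laurent :=
  (t.T0 - (t.k0 - t.k0⁻¹) • LinearMap.id).comp (t.T1 - (t.k1 - t.k1⁻¹) • LinearMap.id)

theorem Yinv_apply (f : Laurent) : t.Yinv f = t.T0 (t.T1 f) - (t.k1 - t.k1⁻¹) • t.T0 f -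
    (t.k0 - t.k0⁻¹) • t.T1 f + ((t.k0 - t.k0⁻¹) * (t.k1 - t.k1⁻¹)) • f := by
  simp only [Yinv, LinearMap.comp_apply, LinearMap.sub_apply, LinearMap.smul_apply,
    LinearMap.id_apply, map_sub, map_smul]
  module

theorem Y_Yinv (f : Laurent) : t.Y (t.Yinv f) = f := by
  simp only [Y, Yinv_apply, LinearMap.comp_apply, map_sub, map_add, map_smul, T0_T0, T1_T1]
  module

theorem Yinv_Y (f : Laurent) : t.Yinv (t.Y f) = f := by
  simp only [Y, Yinv_apply, LinearMap.comp_apply, map_add, map_smul, T0_T0, T1_T1]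
  module

/-- The operator `Y + Y⁻¹`, which commutes with `T₁`. -/
def D : Laurent →ₗ[ℂ] Laurent := t.Y + t.Yinv

/-- By the quadratic relations both sides equal `T₁ T₀ T₁ + T₀ - (k₀ - k₀⁻¹)` applied to `f`. -/
theorem D_T1 (f : Laurent) : t.D (t.T1 f) = t.T1 (t.D f) := by
  simp only [D, Y, LinearMap.add_apply, Yinv_apply, LinearMap.comp_apply, map_sub, map_add,
    map_smul, T1_T1]
  module

theorem eval_weylDenominator {x : ℂ} (hx : x ≠ 0) :
    eval x t.weylDenominator = x⁻¹ * (x - t.a⁻¹) * (x - t.b⁻¹) := by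
  rw [weylDenominator, eval_mul hx, eval_mul hx]
  simp

theorem eval_inv_of_reflection {g : Laurent} (hg : reflection 1 1 g = g) (x : ℂ) :
    eval x⁻¹ g = eval x g := by
  have := eval_reflection 1 (e := 1) (by norm_num) x g
  rw [hg] at this
  simpa using this.symm

/-- Since `δ(x) = (1 - a x)(1 - b x) / (a b x)`, one has `δ(x⁻¹) - δ(x) = (a b - 1)(1 - x²) / (a b
x)`. The denominator of `T₁` cancels, and `a b = -k₁²` leaves the factor `k₁ + k₁⁻¹ (-k₁² - 1) =
-k₁⁻¹`. -/
theorem T1_weylDenominator_mul {g : Laurent} (hg : reflection 1 1 g = g) :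
    t.T1 (t.weylDenominator * g) = (-t.k1⁻¹) • (t.weylDenominator * g) := by
  refine ext_of_eval {1} fun x hx hx1 => ?_
  rw [Finset.mem_singleton] at hx1
  have hx' := inv_ne_zero hx
  rw [eval_T1 t hx hx1, map_smul, eval_mul hx, eval_mul hx', eval_inv_of_reflection hg,
    eval_weylDenominator t hx, eval_weylDenominator t hx', a, b, smul_eq_mul]
  have h1 : 1 - x ^ 2 ≠ 0 := sub_ne_zero.mpr (Ne.symm hx1)
  have := t.k1_ne
  have := t.u1_ne
  field_simp
  ring

set_option maxRecDepth 10000 in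
/-- Multiplication by the generalized Weyl denominator intertwines the operators `Y + Y⁻¹` for the
shifted and the original parameters on symmetric Laurent polynomials. -/
theorem D_weylDenominator_mul {g : Laurent} (hg : reflection 1 1 g = g)
    (hg' : t.shift.T1 g = t.shift.k1 • g) :
    t.D (t.weylDenominator * g) = t.weylDenominator * t.shift.D g := by
  have hqne := t.q_ne
  have hs0 : t.shift.T0 = t.T0 := rfl
  have hsu : t.shift.u1 = t.u1 := rfl
  have hsk0 : t.shift.k0 = t.k0 := rfl
  have hsk : t.shift.k1 = t.q * t.k1 := rfl
  -- These are the poles of `T₁` at `x`, of `T₀` at `x`, and of `T₀` at `x⁻¹`.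
  refine ext_of_eval {1, t.q, t.q⁻¹} fun x hx hx1 => ?_
  simp only [Finset.mem_insert, Finset.mem_singleton, not_or] at hx1
  obtain ⟨hx1, hxq, hxq'⟩ := hx1
  have hx' := inv_ne_zero hx
  have hx'q : (x⁻¹) ^ 2 ≠ t.q := by
    intro hc
    rw [← hc] at hxq'
    simp at hxq'
  have hqx : t.q * x⁻¹ ≠ 0 := mul_ne_zero hqne hx'
  have hqx' : t.q * x ≠ 0 := mul_ne_zero hqne hx
  have hinv : (t.q * x⁻¹)⁻¹ = t.q⁻¹ * x := by field_simp
  simp only [D, Y, LinearMap.add_apply, LinearMap.comp_apply, Yinv_apply,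
    T1_weylDenominator_mul t hg, hg', map_add, map_sub, map_smul, eval_mul hx, hs0]
  rw [eval_T1 t hx hx1, eval_T1 t.shift hx hx1, eval_T0 t hx hxq, eval_T0 t hx hxq,
    eval_T0 t hx' hx'q, eval_T0 t hx' hx'q]
  simp only [inv_inv, eval_mul hx, eval_mul hx', eval_mul hqx, eval_mul hqx',
    eval_weylDenominator t hx, eval_weylDenominator t hx', eval_weylDenominator t hqx,
    eval_weylDenominator t hqx', eval_inv_of_reflection hg, smul_eq_mul, hsu, hsk, hsk0, a, b]
  have h1 : 1 - x ^ 2 ≠ 0 := sub_ne_zero.mpr (Ne.symm hx1)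
  have h2 : x ^ 2 - t.sqrtq ^ 2 ≠ 0 := sub_ne_zero.mpr hxq
  have h3 : 1 - t.sqrtq ^ 2 * x ^ 2 ≠ 0 := by
    intro hc
    apply hx'q
    rw [q]
    field_simp
    linear_combination hc
  have e2 : 1 - (t.sqrtq * x⁻¹) ^ 2 = (x ^ 2 - t.sqrtq ^ 2) / x ^ 2 := by field_simp
  rw [e2, mul_pow t.sqrtq x]
  have := t.k1_ne
  have := t.u1_ne
  have := t.k0_ne
  have := t.u0_ne
  have := t.sqrtq_ne
  rw [q]
  -- By symmetry of `g` only its values at `x`, `q x⁻¹` and `q x` occur; the claim is linear in them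
  -- with rational coefficients.
  generalize eval x g = A
  generalize eval (t.sqrtq ^ 2 * x⁻¹) g = B
  generalize eval (t.sqrtq ^ 2 * x) g = E
  generalize t.sqrtq = h at *
  generalize t.k0 = k0 at *
  generalize t.k1 = k1 at *
  generalize t.u0 = u0 at *
  generalize t.u1 = u1 at *
  clear hxq hxq' hx'q hqx hqx' hinv hs0 hsu hsk hsk0 hg hg' e2
  -- The denominators stay atoms while fractions are cleared and are expanded only for `ring`.
  generalize hd1 : 1 - x ^ 2 = d1 at *
  generalize hd2 : x ^ 2 - h ^ 2 = d2 at *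
  generalize hd3 : 1 - h ^ 2 * x ^ 2 = d3 at *
  field_simp
  subst hd1 hd2 hd3
  ring

end Params

/-! ### The filtration by the total order on monomials -/

/-- The position of `x ^ m` in the total order `1 ≺ x⁻¹ ≺ x ≺ x⁻² ≺ x² ≺ ⋯`. -/
def position (m : ℤ) : ℕ := if 0 ≤ m then (2 * m).toNat else (-2 * m - 1).toNat

theorem position_lt_position {m n : ℤ} : position m < position n ↔ MonomialLT m n := by
  unfold position MonomialLT
  rcases abs_cases m with ⟨h1, h2⟩ | ⟨h1, h2⟩ <;> rcases abs_cases n with ⟨h3, h4⟩ | ⟨h3, h4⟩ <;>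
    rw [h1, h3] <;> split_ifs <;> omega

theorem position_injective : Function.Injective position := by
  intro m n h
  unfold position at h
  split_ifs at h <;> omega

theorem position_surjective : Function.Surjective position := by
  intro N
  rcases Nat.even_or_odd' N with ⟨k, rfl | rfl⟩
  · exact ⟨k, by unfold position; split_ifs <;> omega⟩
  · exact ⟨-(k + 1 : ℤ), by unfold position; split_ifs <;> omega⟩

theorem position_natCast (n : ℕ) : position n = 2 * n := by
  unfold position; split_ifs <;> omega

theorem position_neg (p : ℕ) : position (-(p + 1 : ℤ)) = 2 * p + 1 := by
  unfold position; split_ifs <;> omega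

/-- So `initialSpan (2 * p + 1)` is the span of `x ^ (-p), …, x ^ p`, the form in which the
filtration is stable under `T₀` and `T₁`. -/
theorem position_lt_iff {m : ℤ} {p : ℕ} : position m < 2 * p + 1 ↔ -(p : ℤ) ≤ m ∧ m ≤ p := by
  unfold position; split_ifs <;> omega

/-- The span of the first `N` monomials. -/
def initialSpan (N : ℕ) : Submodule ℂ Laurent where
  carrier := {f | ∀ n : ℤ, N ≤ position n → f.coeff n = 0}
  add_mem' hf hg n hn := by simp [hf n hn, hg n hn]
  zero_mem' n _ := by simp
  smul_mem' c f hf n hn := by simp [hf n hn]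

theorem initialSpan_mono {M N : ℕ} (h : M ≤ N) : initialSpan M ≤ initialSpan N :=
  fun _ hf n hn => hf n (h.trans hn)

theorem T_mem_initialSpan {N : ℕ} {m : ℤ} (h : position m < N) :
    LaurentPolynomial.T m ∈ initialSpan N := by
  intro n hn
  rw [LaurentPolynomial.T_apply, if_neg]
  rintro rfl
  omega

theorem eq_zero_of_mem_initialSpan_zero {f : Laurent} (hf : f ∈ initialSpan 0) : f = 0 := by
  ext n
  simpa using hf n (Nat.zero_le _)

theorem exists_mem_initialSpan (f : Laurent) : ∃ N, f ∈ initialSpan N := by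
  refine ⟨f.coeff.support.sup position + 1, fun n hn => ?_⟩
  by_contra hc
  have := Finset.le_sup (f := position) (Finsupp.mem_support_iff.mpr hc)
  omega

theorem sub_smul_T_mem_initialSpan {f : Laurent} {n : ℤ} (hf : f ∈ initialSpan (position n + 1)) :
    f - f.coeff n • LaurentPolynomial.T n ∈ initialSpan (position n) := by
  intro k hk
  by_cases hkn : k = n
  · subst hkn
    simp
  · have h1 : position n + 1 ≤ position k :=
      lt_of_le_of_ne hk fun h => hkn (position_injective h.symm)
    simp [hf k h1, Ne.symm hkn]

/-- A linear map that sends the first `N` monomials to a subspace sends their span there. -/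
theorem map_mem_of_T (φ : Laurent →ₗ[ℂ] Laurent) (S : Submodule ℂ Laurent) {N : ℕ}
    (h : ∀ m : ℤ, position m < N → φ (LaurentPolynomial.T m) ∈ S) {f : Laurent}
    (hf : f ∈ initialSpan N) : φ f ∈ S := by
  induction N generalizing f with
  | zero => rw [eq_zero_of_mem_initialSpan_zero hf, map_zero]; exact S.zero_mem
  | succ N ih =>
    obtain ⟨n, rfl⟩ := position_surjective N
    have h1 := ih (fun m hm => h m (hm.trans (Nat.lt_succ_self _))) (sub_smul_T_mem_initialSpan hf)
    have h2 := S.smul_mem (f.coeff n) (h n (Nat.lt_succ_self _))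
    have h3 := S.add_mem h1 h2
    rwa [map_sub, map_smul, sub_add_cancel] at h3

theorem monicOfDegree_iff {m : ℤ} {f : Laurent} :
    MonicOfDegree m f ↔ f.coeff m = 1 ∧ f ∈ initialSpan (position m + 1) := by
  refine and_congr_right fun _ => forall_congr' fun n => ?_
  rw [← position_lt_position, ← position_injective.eq_iff, ← le_iff_eq_or_lt, Nat.succ_le_iff,
    ← not_lt, ne_eq, not_imp_not]

/-! ### Eigenvectors of triangular operators -/

section Triangular

variable {φ : Laurent →ₗ[ℂ] Laurent} {c : ℤ → ℂ}

theorem coeff_of_triangular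
    (hφ : ∀ m, φ (LaurentPolynomial.T m) - c m • LaurentPolynomial.T m ∈ initialSpan (position m))
    {n : ℤ} {f : Laurent} (hf : f ∈ initialSpan (position n + 1)) :
    (φ f).coeff n = c n * f.coeff n := by
  have h1 : φ (f - f.coeff n • LaurentPolynomial.T n) ∈ initialSpan (position n) := by
    refine map_mem_of_T φ _ (fun m hm => ?_) (sub_smul_T_mem_initialSpan hf)
    have h2 := (initialSpan _).add_mem (initialSpan_mono hm.le (hφ m))
      ((initialSpan _).smul_mem (c m) (T_mem_initialSpan hm))
    rwa [sub_add_cancel] at h2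
  have h2 := (initialSpan _).add_mem h1 ((initialSpan _).smul_mem (f.coeff n) (hφ n))
  have h3 := h2 n le_rfl
  simp only [map_sub, map_smul, AddMonoidAlgebra.coeff_add, AddMonoidAlgebra.coeff_sub,
    AddMonoidAlgebra.coeff_smul, Finsupp.add_apply, Finsupp.sub_apply, Finsupp.smul_apply,
    LaurentPolynomial.T_apply, if_true, smul_eq_mul] at h3
  linear_combination h3

/-- An eigenvector of a triangular operator vanishes if its coefficient at the monomial that
belongs to the eigenvalue does. -/
theorem eq_zero_of_triangular
    (hφ : ∀ m, φ (LaurentPolynomial.T m) - c m • LaurentPolynomial.T m ∈ initialSpan (position m))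
    (hc : Function.Injective c) {m : ℤ} {f : Laurent} (hf : φ f = c m • f) (h0 : f.coeff m = 0) :
    f = 0 := by
  obtain ⟨N, hN⟩ := exists_mem_initialSpan f
  induction N with
  | zero => exact eq_zero_of_mem_initialSpan_zero hN
  | succ N ih =>
    obtain ⟨n, rfl⟩ := position_surjective N
    have hn : f.coeff n = 0 := by
      by_cases hnm : n = m
      · rw [hnm, h0]
      · have h1 := coeff_of_triangular hφ hN
        rw [hf, AddMonoidAlgebra.coeff_smul, Finsupp.smul_apply, smul_eq_mul] at h1
        have h2 : (c m - c n) * f.coeff n = 0 := by linear_combination h1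
        exact (mul_eq_zero.mp h2).resolve_left
          (sub_ne_zero.mpr fun h => hnm (hc h.symm))
    apply ih
    have := sub_smul_T_mem_initialSpan hN
    rwa [hn, zero_smul, sub_zero] at this

/-- Back substitution: `φ - s` is triangular on the first `N` monomials, with non-zero diagonal
entries `c n - s`. -/
theorem exists_solution_of_triangular
    (hφ : ∀ m, φ (LaurentPolynomial.T m) - c m • LaurentPolynomial.T m ∈ initialSpan (position m))
    {s : ℂ} {N : ℕ} (hs : ∀ n, position n < N → c n ≠ s) {f : Laurent} (hf : f ∈ initialSpan N) :
    ∃ g ∈ initialSpan N, φ g - s • g = f := by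
  induction N generalizing f with
  | zero => exact ⟨0, Submodule.zero_mem _, by simp [eq_zero_of_mem_initialSpan_zero hf]⟩
  | succ N ih =>
    obtain ⟨n, rfl⟩ := position_surjective N
    have hn : c n - s ≠ 0 := sub_ne_zero.mpr (hs n (Nat.lt_succ_self _))
    set d := f.coeff n / (c n - s) with hd
    have h1 : f - d • (φ (LaurentPolynomial.T n) - s • LaurentPolynomial.T n) ∈
        initialSpan (position n) := by
      have h2 := (initialSpan _).sub_mem (sub_smul_T_mem_initialSpan hf)
        ((initialSpan _).smul_mem d (hφ n))
      have h3 : f.coeff n = d * (c n - s) := by rw [hd, div_mul_cancel₀ _ hn]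
      convert h2 using 1
      rw [h3]
      module
    obtain ⟨g, hg, hgf⟩ := ih (fun k hk => hs k (hk.trans (Nat.lt_succ_self _))) h1
    refine ⟨g + d • LaurentPolynomial.T n, Submodule.add_mem _
      (initialSpan_mono (Nat.le_succ _) hg)
      (Submodule.smul_mem _ _ (T_mem_initialSpan (Nat.lt_succ_self _))), ?_⟩
    rw [eq_sub_iff_add_eq] at hgf
    rw [map_add, map_smul, ← hgf]
    module

theorem existsUnique_monic_eigenvector
    (hφ : ∀ m, φ (LaurentPolynomial.T m) - c m • LaurentPolynomial.T m ∈ initialSpan (position m))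
    (hc : Function.Injective c) (m : ℤ) :
    ∃! f : Laurent, MonicOfDegree m f ∧ φ f = c m • f := by
  -- The lower order part `g` corrects the defect of `x ^ m`, so that `x ^ m - g` is an eigenvector.
  obtain ⟨g, hg, hgf⟩ := exists_solution_of_triangular hφ (s := c m) (N := position m)
    (fun n hn h => by rw [hc h] at hn; exact lt_irrefl _ hn) (hφ m)
  refine ⟨LaurentPolynomial.T m - g, ⟨monicOfDegree_iff.mpr ⟨?_, ?_⟩, ?_⟩, ?_⟩
  · simp [hg m le_rfl]
  · exact Submodule.sub_mem _ (T_mem_initialSpan (Nat.lt_succ_self _))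
      (initialSpan_mono (Nat.le_succ _) hg)
  · rw [map_sub, smul_sub]
    linear_combination (exp := 1) -hgf
  · rintro f ⟨hf, hf'⟩
    rw [← sub_eq_zero]
    refine eq_zero_of_triangular hφ hc (m := m) ?_ ?_
    · rw [map_sub, map_sub, hf']
      rw [smul_sub, smul_sub]
      linear_combination (exp := 1) hgf
    · simp [hf.1, hg m le_rfl]

end Triangular

/-! ### Triangularity of the difference-reflection operators -/

/-- The monomial `x ^ (j a / 2)` for the root `a` with `x ^ (a / 2) = h x ^ e`. -/
def halfRootMonomial (h : ℂ) (e j : ℤ) : Laurent := h ^ j • LaurentPolynomial.T (e * j)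

theorem halfRootMonomial_add {h : ℂ} (hh : h ≠ 0) (e i j : ℤ) :
    halfRootMonomial h e (i + j) = halfRootMonomial h e i * halfRootMonomial h e j := by
  simp only [halfRootMonomial, mul_add, zpow_add₀ hh, LaurentPolynomial.T_add, smul_mul_smul_comm]

theorem rootMonomial_eq (h : ℂ) (e j : ℤ) :
    rootMonomial h e j = halfRootMonomial h e (2 * j) := by
  rw [rootMonomial, halfRootMonomial]
  congr 2
  ring

theorem halfRootMonomial_mem {h : ℂ} {e : ℤ} (he : e * e = 1) {p : ℕ} {j : ℤ}
    (h1 : -(p : ℤ) ≤ j) (h2 : j ≤ p) : halfRootMonomial h e j ∈ initialSpan (2 * p + 1) := by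
  refine Submodule.smul_mem _ _ (T_mem_initialSpan (position_lt_iff.mpr ?_))
  rcases mul_self_eq_one_iff.mp he with rfl | rfl <;> constructor <;> linarith

theorem dividedDifference_halfRootMonomial_pos {h : ℂ} (hh : h ≠ 0) {e : ℤ} (he : e * e = 1)
    (p : ℕ) : dividedDifference h e (halfRootMonomial h e (p + 1)) =
      -∑ j ∈ Finset.range (p + 1), halfRootMonomial h e (2 * j - (p + 1)) := by
  have h1 : e * (e * ((p : ℤ) + 1)) = p + 1 := by linear_combination ((p : ℤ) + 1) * he
  conv_lhs => rw [halfRootMonomial, map_smul, dividedDifference, ofMonomials_T, h1,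
    if_pos (by positivity)]
  rw [smul_neg, Finset.smul_sum, ← Finset.sum_range_reflect]
  congr 1
  refine Finset.sum_congr (by congr 1) fun j hj => ?_
  rw [← smul_mul_assoc, rootMonomial_eq]
  change halfRootMonomial h e (p + 1) * _ = _
  rw [← halfRootMonomial_add hh]
  congr 1
  rw [Finset.mem_range] at hj
  omega

theorem dividedDifference_halfRootMonomial_neg {h : ℂ} (hh : h ≠ 0) {e : ℤ} (he : e * e = 1)
    (p : ℕ) : dividedDifference h e (halfRootMonomial h e (-(p + 1))) =
      ∑ j ∈ Finset.range (p + 1), halfRootMonomial h e (2 * j - (p + 1)) := by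
  have h1 : e * (e * -((p : ℤ) + 1)) = -(p + 1) := by linear_combination (-((p : ℤ) + 1)) * he
  conv_lhs => rw [halfRootMonomial, map_smul, dividedDifference, ofMonomials_T, h1,
    if_neg (by omega), neg_neg]
  rw [Finset.smul_sum]
  refine Finset.sum_congr (by congr 1) fun j hj => ?_
  rw [← smul_mul_assoc, rootMonomial_eq]
  change halfRootMonomial h e (-(p + 1)) * _ = _
  rw [← halfRootMonomial_add hh]
  congr 1

/-- With `X = x ^ (a / 2)` the prefactor is `1 + (k u⁻¹ - k u) X - k² X²`, and the sum has exponents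
`-(p + 1), -(p - 1), …, p - 1`. Only the lowest term times `1` and the highest times `X²` leave the
range `-p, …, p`. -/
theorem heckeFactor_mul_sum_mem {h : ℂ} (hh : h ≠ 0) {e : ℤ} (he : e * e = 1) {k u : ℂ}
    (hu : u ≠ 0) (p : ℕ) :
    ((1 - (k * u * h) • LaurentPolynomial.T e) * (1 + (k * u⁻¹ * h) • LaurentPolynomial.T e)) *
      ∑ j ∈ Finset.range (p + 1), halfRootMonomial h e (2 * j - (p + 1)) -
      (halfRootMonomial h e (-(p + 1)) - k ^ 2 • halfRootMonomial h e (p + 1)) ∈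
        initialSpan (2 * p + 1) := by
  have hX : halfRootMonomial h e 1 = h • LaurentPolynomial.T e := by simp [halfRootMonomial]
  have hP : (1 - (k * u * h) • LaurentPolynomial.T e) * (1 + (k * u⁻¹ * h) • LaurentPolynomial.T e)
      = 1 + (k * u⁻¹ - k * u) • halfRootMonomial h e 1 - k ^ 2 • halfRootMonomial h e 2 := by
    rw [show (2 : ℤ) = 1 + 1 by norm_num, halfRootMonomial_add hh, hX]
    simp only [Algebra.smul_def, map_mul, map_pow, map_sub]
    have : algebraMap ℂ Laurent u * algebraMap ℂ Laurent u⁻¹ = 1 := by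
      rw [← map_mul, mul_inv_cancel₀ hu, map_one]
    linear_combination (-(algebraMap ℂ Laurent k) ^ 2 * (algebraMap ℂ Laurent h) ^ 2 *
      LaurentPolynomial.T e ^ 2) * this
  have h0 : ∑ j ∈ Finset.range (p + 1), halfRootMonomial h e (2 * j - (p + 1)) =
      ∑ j ∈ Finset.range p, halfRootMonomial h e (2 * j + 1 - p) +
        halfRootMonomial h e (-(p + 1)) := by
    rw [Finset.sum_range_succ']
    congr 1
    · refine Finset.sum_congr rfl fun j _ => ?_
      congr 1
      push_cast
      ring
  have h1 : halfRootMonomial h e 1 *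
      ∑ j ∈ Finset.range (p + 1), halfRootMonomial h e (2 * j - (p + 1)) =
        ∑ j ∈ Finset.range (p + 1), halfRootMonomial h e (2 * j - p) := by
    rw [Finset.mul_sum]
    refine Finset.sum_congr rfl fun j _ => ?_
    rw [← halfRootMonomial_add hh]
    congr 1
    ring
  have h2 : halfRootMonomial h e 2 *
      ∑ j ∈ Finset.range (p + 1), halfRootMonomial h e (2 * j - (p + 1)) =
        ∑ j ∈ Finset.range p, halfRootMonomial h e (2 * j + 1 - p) +
          halfRootMonomial h e (p + 1) := by
    rw [Finset.mul_sum, Finset.sum_range_succ, ← halfRootMonomial_add hh]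
    congr 1
    · refine Finset.sum_congr rfl fun j _ => ?_
      rw [← halfRootMonomial_add hh]
      congr 1
      ring
    · congr 1
      ring
  have m0 : ∑ j ∈ Finset.range p, halfRootMonomial h e (2 * j + 1 - p) ∈
      initialSpan (2 * p + 1) := by
    refine Submodule.sum_mem _ fun j hj => ?_
    rw [Finset.mem_range] at hj
    exact halfRootMonomial_mem he (by omega) (by omega)
  have m1 : ∑ j ∈ Finset.range (p + 1), halfRootMonomial h e (2 * j - p) ∈
      initialSpan (2 * p + 1) := by
    refine Submodule.sum_mem _ fun j hj => ?_
    rw [Finset.mem_range] at hj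
    exact halfRootMonomial_mem he (by omega) (by omega)
  rw [hP, sub_mul, add_mul, smul_mul_assoc, smul_mul_assoc, h1, h2, one_mul, h0]
  have := Submodule.sub_mem _ (Submodule.add_mem _ m0 (Submodule.smul_mem _ (k * u⁻¹ - k * u) m1))
    (Submodule.smul_mem _ (k ^ 2) m0)
  convert this using 1
  module

theorem heckeOperator_halfRootMonomial_pos {h : ℂ} (hh : h ≠ 0) {e : ℤ} (he : e * e = 1) {k u : ℂ}
    (hk : k ≠ 0) (hu : u ≠ 0) (p : ℕ) :
    heckeOperator h e k u (halfRootMonomial h e (p + 1)) -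
      k⁻¹ • halfRootMonomial h e (-(p + 1)) ∈ initialSpan (2 * p + 1) := by
  have := Submodule.smul_mem _ k⁻¹ (heckeFactor_mul_sum_mem hh he (k := k) hu p)
  convert this using 1
  simp only [heckeOperator, LinearMap.sub_apply, LinearMap.smul_apply, LinearMap.id_apply,
    LinearMap.comp_apply, LinearMap.mulLeft_apply, dividedDifference_halfRootMonomial_pos hh he,
    mul_neg, smul_sub, smul_smul, show k⁻¹ * k ^ 2 = k by field_simp]
  module

theorem heckeOperator_halfRootMonomial_neg {h : ℂ} (hh : h ≠ 0) {e : ℤ} (he : e * e = 1) {k u : ℂ}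
    (hk : k ≠ 0) (hu : u ≠ 0) (p : ℕ) :
    heckeOperator h e k u (halfRootMonomial h e (-(p + 1))) -
      (k • halfRootMonomial h e (p + 1) + (k - k⁻¹) • halfRootMonomial h e (-(p + 1))) ∈
        initialSpan (2 * p + 1) := by
  have := Submodule.smul_mem _ (-k⁻¹) (heckeFactor_mul_sum_mem hh he (k := k) hu p)
  convert this using 1
  simp only [heckeOperator, LinearMap.sub_apply, LinearMap.smul_apply, LinearMap.id_apply,
    LinearMap.comp_apply, LinearMap.mulLeft_apply, dividedDifference_halfRootMonomial_neg hh he,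
    smul_sub, smul_smul, show -k⁻¹ * k ^ 2 = -k by field_simp]
  module

theorem halfRootMonomial_one_one (j : ℤ) : halfRootMonomial 1 1 j = LaurentPolynomial.T j := by
  simp [halfRootMonomial]

theorem T_eq_smul_halfRootMonomial {h : ℂ} (hh : h ≠ 0) {e : ℤ} (he : e * e = 1) (j : ℤ) :
    LaurentPolynomial.T j = h ^ (-(e * j)) • halfRootMonomial h e (e * j) := by
  rw [halfRootMonomial, smul_smul, ← zpow_add₀ hh, neg_add_cancel, zpow_zero, one_smul]
  congr 1
  linear_combination (-j) * he

theorem heckeOperator_mem {h : ℂ} (hh : h ≠ 0) {e : ℤ} (he : e * e = 1) {k u : ℂ}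
    (hk : k ≠ 0) (hu : u ≠ 0) {p : ℕ} {f : Laurent} (hf : f ∈ initialSpan (2 * p + 1)) :
    heckeOperator h e k u f ∈ initialSpan (2 * p + 1) := by
  refine map_mem_of_T _ _ (fun m hm => ?_) hf
  rw [position_lt_iff] at hm
  rw [T_eq_smul_halfRootMonomial hh he, map_smul]
  refine Submodule.smul_mem _ _ ?_
  have hb : -(p : ℤ) ≤ e * m ∧ e * m ≤ p := by
    rcases mul_self_eq_one_iff.mp he with rfl | rfl <;> constructor <;> linarith
  generalize e * m = j at hb
  rcases lt_trichotomy j 0 with hj | rfl | hj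
  · obtain ⟨r, rfl⟩ : ∃ r : ℕ, j = -(r + 1) := ⟨(-j - 1).toNat, by omega⟩
    have h1 := initialSpan_mono (show 2 * r + 1 ≤ 2 * p + 1 by omega)
      (heckeOperator_halfRootMonomial_neg hh he hk hu r)
    have h2 := Submodule.add_mem _
      (Submodule.smul_mem _ k (halfRootMonomial_mem (h := h) he (p := p) (j := r + 1) (by omega)
        (by omega)))
      (Submodule.smul_mem _ (k - k⁻¹) (halfRootMonomial_mem (h := h) he hb.1 hb.2))
    exact (Submodule.sub_mem_iff_left _ h2).mp h1
  · have : halfRootMonomial h e 0 = 1 := by simp [halfRootMonomial]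
    rw [this, heckeOperator_one, ← this]
    exact Submodule.smul_mem _ _ (halfRootMonomial_mem he hb.1 hb.2)
  · obtain ⟨r, rfl⟩ : ∃ r : ℕ, j = r + 1 := ⟨(j - 1).toNat, by omega⟩
    have h1 := initialSpan_mono (show 2 * r + 1 ≤ 2 * p + 1 by omega)
      (heckeOperator_halfRootMonomial_pos hh he hk hu r)
    have h2 := Submodule.smul_mem _ k⁻¹ (halfRootMonomial_mem (h := h) he (p := p)
      (j := -(r + 1)) (by omega) (by omega))
    exact (Submodule.sub_mem_iff_left _ h2).mp h1

/-! ### Leading terms of `T₁`, `T₀` and `Y` -/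

namespace Params

variable (t : Params)

theorem T1_mem {p : ℕ} {f : Laurent} (hf : f ∈ initialSpan (2 * p + 1)) :
    t.T1 f ∈ initialSpan (2 * p + 1) :=
  heckeOperator_mem one_ne_zero (by norm_num) t.k1_ne t.u1_ne hf

theorem T1_T_pos (p : ℕ) : t.T1 (LaurentPolynomial.T (p + 1)) -
    t.k1⁻¹ • LaurentPolynomial.T (-(p + 1)) ∈ initialSpan (2 * p + 1) := by
  simpa only [halfRootMonomial_one_one, T1] using
    heckeOperator_halfRootMonomial_pos one_ne_zero (e := 1) (by norm_num) t.k1_ne t.u1_ne p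

theorem T1_T_neg (p : ℕ) : t.T1 (LaurentPolynomial.T (-(p + 1))) -
    (t.k1 • LaurentPolynomial.T (p + 1) + (t.k1 - t.k1⁻¹) • LaurentPolynomial.T (-(p + 1))) ∈
      initialSpan (2 * p + 1) := by
  simpa only [halfRootMonomial_one_one, T1] using
    heckeOperator_halfRootMonomial_neg one_ne_zero (e := 1) (by norm_num) t.k1_ne t.u1_ne p

/-- For `a₀` one has `X = q ^ (1 / 2) x⁻¹`, so positive powers of `x` are negative powers of `X`;
the two rescalings by `q ^ ((p + 1) / 2)` combine to `q ^ (p + 1)`. -/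
theorem T0_T_pos (p : ℕ) : t.T0 (LaurentPolynomial.T (p + 1)) -
    ((t.k0 * t.q ^ (p + 1 : ℤ)) • LaurentPolynomial.T (-(p + 1)) +
      (t.k0 - t.k0⁻¹) • LaurentPolynomial.T (p + 1)) ∈ initialSpan (2 * p + 1) := by
  have h1 := Submodule.smul_mem _ (t.sqrtq ^ (p + 1 : ℤ)) (heckeOperator_halfRootMonomial_neg
    t.sqrtq_ne (e := -1) (by norm_num) t.k0_ne t.u0_ne p)
  have h2 : LaurentPolynomial.T (p + 1) =
      t.sqrtq ^ (p + 1 : ℤ) • halfRootMonomial t.sqrtq (-1) (-(p + 1)) := by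
    simpa using T_eq_smul_halfRootMonomial t.sqrtq_ne (e := -1) (by norm_num) (p + 1)
  have h3 : t.q ^ (p + 1 : ℤ) • LaurentPolynomial.T (-(p + 1)) =
      t.sqrtq ^ (p + 1 : ℤ) • halfRootMonomial t.sqrtq (-1) (p + 1) := by
    rw [halfRootMonomial, smul_smul, q, ← mul_zpow, sq]
    simp
  rw [mul_smul, h3, h2, map_smul]
  convert h1 using 1
  rw [T0]
  module

theorem T0_T_neg (p : ℕ) : t.T0 (LaurentPolynomial.T (-(p + 1))) -
    (t.k0⁻¹ * t.q ^ (-(p + 1) : ℤ)) • LaurentPolynomial.T (p + 1) ∈ initialSpan (2 * p + 1) := by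
  have h1 := Submodule.smul_mem _ (t.sqrtq ^ (-(p + 1) : ℤ)) (heckeOperator_halfRootMonomial_pos
    t.sqrtq_ne (e := -1) (by norm_num) t.k0_ne t.u0_ne p)
  have h2 : LaurentPolynomial.T (-(p + 1)) =
      t.sqrtq ^ (-(p + 1) : ℤ) • halfRootMonomial t.sqrtq (-1) (p + 1) := by
    simpa using T_eq_smul_halfRootMonomial t.sqrtq_ne (e := -1) (by norm_num) (-(p + 1))
  have h3 : t.q ^ (-(p + 1) : ℤ) • LaurentPolynomial.T (p + 1) =
      t.sqrtq ^ (-(p + 1) : ℤ) • halfRootMonomial t.sqrtq (-1) (-(p + 1)) := by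
    rw [halfRootMonomial, smul_smul, q, ← mul_zpow, sq]
    simp
  rw [mul_smul, h3, h2, map_smul]
  convert h1 using 1
  rw [T0]
  module

theorem T1_one : t.T1 1 = t.k1 • 1 := heckeOperator_one _ _

theorem Y_one : t.Y 1 = (t.k0 * t.k1) • 1 := by
  rw [Y, LinearMap.comp_apply, T0, heckeOperator_one, map_smul, T1_one, smul_smul]

/-- Triangularity of the Cherednik-Dunkl operator. -/
theorem Y_triangular (m : ℤ) :
    t.Y (LaurentPolynomial.T m) - t.γ m • LaurentPolynomial.T m ∈ initialSpan (position m) := by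
  rcases lt_trichotomy m 0 with hm | rfl | hm
  · obtain ⟨p, rfl⟩ : ∃ p : ℕ, m = -(p + 1) := ⟨(-m - 1).toNat, by omega⟩
    rw [position_neg, γ, if_neg (by omega)]
    have h := Submodule.add_mem _ (t.T1_mem (t.T0_T_neg p))
      (Submodule.smul_mem _ (t.k0⁻¹ * t.q ^ (-(p + 1) : ℤ)) (t.T1_T_pos p))
    convert h using 1
    rw [map_sub, map_smul, Y, LinearMap.comp_apply]
    module
  · rw [LaurentPolynomial.T_zero, Y_one, γ, if_pos le_rfl]
    simp
  · obtain ⟨p, rfl⟩ : ∃ p : ℕ, m = p + 1 := ⟨(m - 1).toNat, by omega⟩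
    have hpos : position ((p : ℤ) + 1) = 2 * p + 2 := by
      simpa [mul_add] using position_natCast (p + 1)
    -- For positive degree the monomial `x ^ (-(p + 1))` is itself a lower order term, so its
    -- coefficient is irrelevant.
    have hT : LaurentPolynomial.T (-(p + 1)) ∈ initialSpan (2 * p + 2) :=
      T_mem_initialSpan (by rw [position_neg]; omega)
    have hle := initialSpan_mono (show 2 * p + 1 ≤ 2 * p + 2 by omega)
    rw [hpos, γ, if_pos (by omega)]
    have h := Submodule.add_mem _ (Submodule.add_mem _ (hle (t.T1_mem (t.T0_T_pos p)))
      (Submodule.smul_mem _ (t.k0 * t.q ^ (p + 1 : ℤ)) (hle (t.T1_T_neg p))))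
      (Submodule.add_mem _ (Submodule.smul_mem _ (t.k0 - t.k0⁻¹) (hle (t.T1_T_pos p)))
        (Submodule.smul_mem _ (t.k0 * t.q ^ (p + 1 : ℤ) * (t.k1 - t.k1⁻¹) +
          (t.k0 - t.k0⁻¹) * t.k1⁻¹) hT))
    convert h using 1
    rw [map_sub, map_add, map_smul, map_smul, Y, LinearMap.comp_apply]
    module

end Params

namespace Params

variable {t : Params}

/-! ### The non-symmetric polynomials and the spaces `𝒜(m)` -/

theorem q_zpow_injective (ht : t.Generic) : Function.Injective fun n : ℤ => t.q ^ n := by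
  have h0 : 0 < ‖t.q‖ := norm_pos_iff.mpr t.q_ne
  intro m n h
  have h1 := congrArg norm h
  simp only [norm_zpow] at h1
  exact zpow_right_injective₀ h0 ht.norm_q h1

theorem γ_injective (ht : t.Generic) : Function.Injective t.γ := by
  have hk := mul_ne_zero t.k0_ne t.k1_ne
  have hk0 := t.k0_ne
  have hk1 := t.k1_ne
  have key : ∀ m n : ℤ, 0 ≤ m → n < 0 → t.γ m ≠ t.γ n := by
    intro m n hm hn h
    rw [γ, γ, if_pos hm, if_neg (not_le.mpr hn)] at h
    -- A coincidence across the two signs would give `k₀² k₁² = q ^ (n - m)` with `n - m < 0`.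
    refine ht.k0_k1_sq (n - m) (by omega) ?_
    rw [zpow_sub₀ t.q_ne, eq_div_iff (zpow_ne_zero m t.q_ne)]
    field_simp at h
    linear_combination h
  intro m n h
  rcases le_or_gt 0 m with hm | hm <;> rcases le_or_gt 0 n with hn | hn
  · rw [γ, γ, if_pos hm, if_pos hn] at h
    exact q_zpow_injective ht (mul_left_cancel₀ hk h)
  · exact absurd h (key m n hm hn)
  · exact absurd h.symm (key n m hn hm)
  · rw [γ, γ, if_neg (not_le.mpr hm), if_neg (not_le.mpr hn)] at h
    exact q_zpow_injective ht (mul_left_cancel₀ (by positivity) h)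

theorem γ_ne_zero (t : Params) (m : ℤ) : t.γ m ≠ 0 := by
  have h0 := t.k0_ne
  have h1 := t.k1_ne
  have h2 := zpow_ne_zero m t.q_ne
  unfold γ
  split_ifs <;> positivity

theorem γ_neg (t : Params) {m : ℤ} (hm : 0 < m) : t.γ (-m) = (t.γ m)⁻¹ := by
  rw [γ, γ, if_pos hm.le, if_neg (by omega), mul_inv, mul_inv, zpow_neg]

theorem Generic.shift (ht : t.Generic) : t.shift.Generic where
  norm_q := ht.norm_q
  k0_sq := ht.k0_sq
  u1_sq := ht.u1_sq
  k1_sq n := by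
    have h := ht.k1_sq (n - 2)
    have h2 : t.q ^ (2 : ℤ) = t.q ^ 2 := by norm_cast
    have hq := t.q_ne
    rw [zpow_sub₀ hq, h2] at h
    change (t.q * t.k1) ^ 2 ≠ t.q ^ n ∧ (t.q * t.k1) ^ 2 ≠ -t.q ^ n
    refine ⟨fun hc => h.1 ?_, fun hc => h.2 ?_⟩
    · rw [← hc]; field_simp
    · rw [← neg_div, ← hc]; field_simp
  k0_k1_sq n hn := by
    have h := ht.k0_k1_sq (n - 2) (by omega)
    have h2 : t.q ^ (2 : ℤ) = t.q ^ 2 := by norm_cast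
    have hq := t.q_ne
    rw [zpow_sub₀ hq, h2] at h
    change t.k0 ^ 2 * (t.q * t.k1) ^ 2 ≠ t.q ^ n
    intro hc
    apply h
    rw [← hc]
    field_simp

theorem existsUnique_isNonsymmetricAW (ht : t.Generic) (n : ℤ) :
    ∃! f : Laurent, t.IsNonsymmetricAW n f :=
  existsUnique_monic_eigenvector t.Y_triangular (γ_injective ht) n

theorem nonsymmetricAW_spec (ht : t.Generic) (n : ℤ) :
    t.IsNonsymmetricAW n (t.nonsymmetricAW n) :=
  Classical.epsilon_spec (existsUnique_isNonsymmetricAW ht n).exists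

/-- The eigenspaces of `Y` are one-dimensional. -/
theorem eq_smul_nonsymmetricAW (ht : t.Generic) {n : ℤ} {f : Laurent} (hf : t.Y f = t.γ n • f) :
    f = f.coeff n • t.nonsymmetricAW n := by
  obtain ⟨⟨h1, -⟩, h2⟩ := nonsymmetricAW_spec ht n
  rw [← sub_eq_zero]
  refine eq_zero_of_triangular t.Y_triangular (γ_injective ht) (m := n) ?_ ?_
  · rw [map_sub, map_smul, hf, h2]
    module
  · simp [h1]

theorem nonsymmetricAW_zero (ht : t.Generic) : t.nonsymmetricAW 0 = 1 := by
  refine (existsUnique_isNonsymmetricAW ht 0).unique (nonsymmetricAW_spec ht 0) ⟨?_, ?_⟩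
  · rw [monicOfDegree_iff, ← LaurentPolynomial.T_zero]
    exact ⟨by simp, T_mem_initialSpan (Nat.lt_succ_self _)⟩
  · rw [Y_one, γ, if_pos le_rfl, zpow_zero, mul_one]

theorem D_of_eigenvector (t : Params) {s : ℂ} (hs : s ≠ 0) {f : Laurent} (hf : t.Y f = s • f) :
    t.D f = (s + s⁻¹) • f := by
  have h1 : t.Yinv f = s⁻¹ • f := by
    have := t.Yinv_Y f
    rw [hf, map_smul] at this
    rw [← this, smul_smul, inv_mul_cancel₀ hs, one_smul, this]
  rw [D, LinearMap.add_apply, hf, h1, add_smul]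

theorem D_of_mem_component (ht : t.Generic) {m : ℕ} {f : Laurent} (hf : f ∈ t.component m) :
    t.D f = (t.γ m + (t.γ m)⁻¹) • f := by
  obtain ⟨α, β, rfl⟩ := Submodule.mem_span_pair.mp hf
  have h1 := D_of_eigenvector t (t.γ_ne_zero m) (nonsymmetricAW_spec ht m).2
  have h2 : t.D (t.nonsymmetricAW (-m)) =
      (t.γ m + (t.γ m)⁻¹) • t.nonsymmetricAW (-m) := by
    rcases Nat.eq_zero_or_pos m with rfl | hm
    · simpa using h1
    · have := D_of_eigenvector t (t.γ_ne_zero (-m)) (nonsymmetricAW_spec ht (-m)).2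
      rwa [γ_neg t (by exact_mod_cast hm), inv_inv, add_comm] at this
  rw [map_add, map_smul, map_smul, h1, h2]
  module

/-- The hypothesis means `(Y - γ_m)(Y - γ_m⁻¹) f = 0`. For `m ≥ 1` the roots are the different
eigenvalues `γ_m` and `γ_{-m}`, so `f` splits into two eigenvectors of `Y`. -/
theorem mem_component_of_D (ht : t.Generic) {m : ℕ} (hm : 1 ≤ m) {f : Laurent}
    (hf : t.D f = (t.γ m + (t.γ m)⁻¹) • f) : f ∈ t.component m := by
  have hm' : (0 : ℤ) < m := by exact_mod_cast hm
  have hs := t.γ_ne_zero m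
  have hinv := γ_neg t hm'
  have hne : t.γ m - t.γ (-m) ≠ 0 :=
    sub_ne_zero.mpr fun h => by have := γ_injective ht h; omega
  obtain ⟨-, hP⟩ := nonsymmetricAW_spec ht m
  set P := t.nonsymmetricAW m with hPdef
  have hYY : t.Y (t.Y f) = (t.γ m + (t.γ m)⁻¹) • t.Y f - f := by
    have := congrArg t.Y hf
    rw [D, LinearMap.add_apply, map_add, Y_Yinv, map_smul] at this
    exact eq_sub_of_add_eq this
  have h1 : t.Y (t.Y f - t.γ (-m) • f) = t.γ m • (t.Y f - t.γ (-m) • f) := by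
    rw [map_sub, map_smul, hYY, hinv, smul_sub, smul_smul, mul_inv_cancel₀ hs]
    module
  have h2 := eq_smul_nonsymmetricAW ht h1
  set c := (t.Y f - t.γ (-m) • f).coeff m
  set d := c / (t.γ m - t.γ (-m)) with hd
  have hdc : c = d * (t.γ m - t.γ (-m)) := by rw [hd, div_mul_cancel₀ _ hne]
  have h3 : t.Y (f - d • P) = t.γ (-m) • (f - d • P) := by
    rw [sub_eq_iff_eq_add] at h2
    rw [map_sub, map_smul, hP, h2, hdc]
    module
  have h4 := eq_smul_nonsymmetricAW ht h3
  refine Submodule.mem_span_pair.mpr ⟨d, (f - d • P).coeff (-m), ?_⟩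
  rw [← h4, ← hPdef]
  module

theorem T1_mem_component (ht : t.Generic) {m : ℕ} {f : Laurent} (hf : f ∈ t.component m) :
    t.T1 f ∈ t.component m := by
  -- The case `m = 0`, which `mem_component_of_D` does not cover, is direct because `P_0 = 1`.
  rcases Nat.eq_zero_or_pos m with rfl | hm
  · obtain ⟨α, β, rfl⟩ := Submodule.mem_span_pair.mp hf
    have h1 : t.T1 (t.nonsymmetricAW 0) = t.k1 • t.nonsymmetricAW 0 := by
      rw [nonsymmetricAW_zero ht, T1_one]
    have h2 : t.T1 (α • t.nonsymmetricAW (0 : ℕ) + β • t.nonsymmetricAW (-(0 : ℕ))) =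
        t.k1 • (α • t.nonsymmetricAW (0 : ℕ) + β • t.nonsymmetricAW (-(0 : ℕ))) := by
      simp only [Nat.cast_zero, neg_zero, map_add, map_smul, h1]
      module
    rw [h2]
    exact Submodule.smul_mem _ _ hf
  · apply mem_component_of_D ht hm
    rw [D_T1, D_of_mem_component ht hf, map_smul]

theorem component_le (ht : t.Generic) (m : ℕ) : t.component m ≤ initialSpan (2 * m + 1) := by
  rw [component, Submodule.span_le]
  rintro f (rfl | rfl)
  · refine initialSpan_mono ?_ (monicOfDegree_iff.mp (nonsymmetricAW_spec ht m).1).2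
    rw [position_natCast]
  · refine initialSpan_mono ?_ (monicOfDegree_iff.mp (nonsymmetricAW_spec ht (-m)).1).2
    unfold position
    split_ifs <;> omega

/-! ### Symmetric and anti-symmetric polynomials -/

theorem one_add_k1_sq_ne_zero (ht : t.Generic) : 1 + t.k1 ^ 2 ≠ 0 := by
  intro h
  apply (ht.k1_sq 0).2
  rw [zpow_zero]
  linear_combination h

theorem T1_add_smul_T1 (t : Params) (g : Laurent) :
    t.T1 (g + t.k1 • t.T1 g) = t.k1 • (g + t.k1 • t.T1 g) := by
  have hk := t.k1_ne
  rw [map_add, map_smul, T1_T1]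
  match_scalars <;> field_simp
  ring

theorem T1_sub_smul_T1 (t : Params) (g : Laurent) :
    t.T1 (g - t.k1⁻¹ • t.T1 g) = (-t.k1⁻¹) • (g - t.k1⁻¹ • t.T1 g) := by
  have hk := t.k1_ne
  rw [map_sub, map_smul, T1_T1]
  match_scalars <;> field_simp
  ring

theorem mem_map_Cplus (ht : t.Generic) {m : ℕ} {f : Laurent} :
    f ∈ (t.component m).map t.Cplus ↔ f ∈ t.component m ∧ t.T1 f = t.k1 • f := by
  constructor
  · rintro ⟨g, hg, rfl⟩
    refine ⟨Submodule.smul_mem _ _ (Submodule.add_mem _ hg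
      (Submodule.smul_mem _ _ (T1_mem_component ht hg))), ?_⟩
    rw [Cplus, LinearMap.smul_apply, LinearMap.add_apply, LinearMap.id_apply,
      LinearMap.smul_apply, map_smul, T1_add_smul_T1, smul_comm]
  · rintro ⟨hf, hT⟩
    refine ⟨f, hf, ?_⟩
    rw [Cplus, LinearMap.smul_apply, LinearMap.add_apply, LinearMap.id_apply, LinearMap.smul_apply,
      hT, smul_smul, ← sq, inv_smul_eq_iff₀ (one_add_k1_sq_ne_zero ht)]
    module

theorem mem_map_Cminus (ht : t.Generic) {m : ℕ} {f : Laurent} :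
    f ∈ (t.component m).map t.Cminus ↔ f ∈ t.component m ∧ t.T1 f = (-t.k1⁻¹) • f := by
  have hk := t.k1_ne
  constructor
  · rintro ⟨g, hg, rfl⟩
    refine ⟨Submodule.smul_mem _ _ (Submodule.sub_mem _ hg
      (Submodule.smul_mem _ _ (T1_mem_component ht hg))), ?_⟩
    rw [Cminus, LinearMap.smul_apply, LinearMap.sub_apply, LinearMap.id_apply,
      LinearMap.smul_apply, map_smul, T1_sub_smul_T1, smul_comm]
  · rintro ⟨hf, hT⟩
    refine ⟨f, hf, ?_⟩
    have hne : 1 + (t.k1 ^ 2)⁻¹ ≠ 0 := by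
      have := one_add_k1_sq_ne_zero ht
      intro h
      apply this
      field_simp at h
      linear_combination h
    rw [Cminus, LinearMap.smul_apply, LinearMap.sub_apply, LinearMap.id_apply,
      LinearMap.smul_apply, hT, inv_smul_eq_iff₀ hne, ← inv_pow]
    module

/-- Applied to `P_{-m}`, which has no `x ^ m` term, this shows that `P_{-m}` is not an eigenvector
of `T₁`; it also normalizes `P_m⁺`. -/
theorem coeff_T1_of_mem (t : Params) {p : ℕ} {f : Laurent}
    (hf : f ∈ initialSpan (position (-(p + 1 : ℤ)) + 1)) (h1 : f.coeff (-(p + 1)) = 1) :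
    (t.T1 f).coeff (p + 1) = t.k1 := by
  have h2 := sub_smul_T_mem_initialSpan hf
  rw [h1, one_smul, position_neg] at h2
  have h3 := Submodule.add_mem _ (t.T1_mem h2) (t.T1_T_neg p)
  have h4 := h3 (p + 1) (by unfold position; split_ifs <;> omega)
  have hne : -((p : ℤ) + 1) ≠ p + 1 := by omega
  simp only [map_sub, sub_add_sub_cancel, AddMonoidAlgebra.coeff_sub, AddMonoidAlgebra.coeff_add,
    AddMonoidAlgebra.coeff_smul, Finsupp.sub_apply, Finsupp.add_apply, Finsupp.smul_apply,
    LaurentPolynomial.T_apply, if_true, if_neg hne, smul_eq_mul, mul_one, mul_zero, add_zero] at h4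
  exact sub_eq_zero.mp h4

/-- An eigenvector of `T₁` in `𝒜(m)` vanishes if its coefficient at `x ^ m` does. -/
theorem eq_zero_of_T1_eigenvector (ht : t.Generic) {m : ℕ} {κ : ℂ} {f : Laurent}
    (hf : f ∈ t.component m) (hT : t.T1 f = κ • f) (h0 : f.coeff m = 0) : f = 0 := by
  obtain ⟨α, β, rfl⟩ := Submodule.mem_span_pair.mp hf
  rcases Nat.eq_zero_or_pos m with rfl | hm
  · simp only [Nat.cast_zero, neg_zero, ← add_smul] at h0 ⊢
    have h1 := (nonsymmetricAW_spec ht 0).1.1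
    simp only [AddMonoidAlgebra.coeff_smul, Finsupp.smul_apply, h1, smul_eq_mul, mul_one] at h0
    rw [h0, zero_smul]
  · obtain ⟨p, rfl⟩ : ∃ p, m = p + 1 := ⟨m - 1, by omega⟩
    have hP := (nonsymmetricAW_spec ht ((p + 1 : ℕ) : ℤ)).1.1
    obtain ⟨hQ, hQ'⟩ := monicOfDegree_iff.mp (nonsymmetricAW_spec ht (-((p + 1 : ℕ) : ℤ))).1
    set P := t.nonsymmetricAW ((p + 1 : ℕ) : ℤ)
    set Q := t.nonsymmetricAW (-((p + 1 : ℕ) : ℤ))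
    push_cast at *
    have hQ0 : Q.coeff (p + 1) = 0 := by
      apply hQ'
      rw [position_neg]
      unfold position
      split_ifs <;> omega
    have hα : α = 0 := by simpa [hP, hQ0] using h0
    subst hα
    have h1 := coeff_T1_of_mem t hQ' hQ
    simp only [zero_smul, zero_add, map_smul] at hT ⊢
    have h2 := congrArg (fun g : Laurent => g.coeff (p + 1)) hT
    simp only [AddMonoidAlgebra.coeff_smul, Finsupp.smul_apply, h1, hQ0, smul_eq_mul, mul_zero,
      mul_eq_zero, t.k1_ne, or_false] at h2
    rw [h2, zero_smul]

theorem T1_eigenvector_unique (ht : t.Generic) {m : ℕ} {κ : ℂ} {f g : Laurent}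
    (hf : f ∈ t.component m) (hTf : t.T1 f = κ • f) (hf' : MonicOfDegree m f)
    (hg : g ∈ t.component m) (hTg : t.T1 g = κ • g) (hg' : MonicOfDegree m g) : f = g := by
  rw [← sub_eq_zero]
  refine eq_zero_of_T1_eigenvector ht (κ := κ) (Submodule.sub_mem _ hf hg) ?_ ?_
  · rw [map_sub, hTf, hTg, smul_sub]
  · simp [hf'.1, hg'.1]

theorem monicOfDegree_natCast_iff {m : ℕ} {f : Laurent} :
    MonicOfDegree m f ↔ f.coeff m = 1 ∧ f ∈ initialSpan (2 * m + 1) := by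
  rw [monicOfDegree_iff, position_natCast]

theorem existsUnique_isSymmetricAW (ht : t.Generic) (m : ℕ) :
    ∃! f : Laurent, t.IsSymmetricAW m f := by
  refine existsUnique_of_exists_of_unique ?_ ?_
  · rcases Nat.eq_zero_or_pos m with rfl | hm
    · refine ⟨1, (mem_map_Cplus ht).mpr ⟨?_, t.T1_one⟩, ?_⟩
      · rw [← nonsymmetricAW_zero ht]
        exact Submodule.subset_span (Or.inl rfl)
      · rw [← nonsymmetricAW_zero ht]
        exact (nonsymmetricAW_spec ht 0).1
    · obtain ⟨p, rfl⟩ : ∃ p, m = p + 1 := ⟨m - 1, by omega⟩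
      obtain ⟨hQ, hQ'⟩ := monicOfDegree_iff.mp (nonsymmetricAW_spec ht (-((p + 1 : ℕ) : ℤ))).1
      have hmem : t.nonsymmetricAW (-((p + 1 : ℕ) : ℤ)) ∈ t.component (p + 1) :=
        Submodule.subset_span (Or.inr rfl)
      set Q := t.nonsymmetricAW (-((p + 1 : ℕ) : ℤ))
      have hQ0 : Q.coeff ((p + 1 : ℕ) : ℤ) = 0 := by
        apply hQ'
        push_cast
        rw [position_neg]
        unfold position
        split_ifs <;> omega
      -- The witness is `k₁⁻² (1 + k₁ T₁) P_{-m}`; its coefficient at `x ^ m` is `k₁⁻² · k₁ · k₁ =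
      -- 1`.
      have hu := Submodule.smul_mem _ (t.k1 ^ 2)⁻¹ (Submodule.add_mem _ hmem
        (Submodule.smul_mem _ t.k1 (T1_mem_component ht hmem)))
      refine ⟨_, (mem_map_Cplus ht).mpr ⟨hu, ?_⟩,
        monicOfDegree_natCast_iff.mpr ⟨?_, component_le ht _ hu⟩⟩
      · rw [map_smul, T1_add_smul_T1, smul_comm]
      · push_cast at *
        have h1 := coeff_T1_of_mem t hQ' hQ
        have hk := t.k1_ne
        simp only [AddMonoidAlgebra.coeff_smul, AddMonoidAlgebra.coeff_add, Finsupp.add_apply,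
          Finsupp.smul_apply, smul_eq_mul, h1, hQ0]
        field_simp
        ring
  · rintro f g ⟨hf, hf'⟩ ⟨hg, hg'⟩
    rw [mem_map_Cplus ht] at hf hg
    exact T1_eigenvector_unique ht hf.1 hf.2 hf' hg.1 hg.2 hg'

/-! ### Multiplication by the Weyl denominator as a shift from degree `p` to `p + 1` -/

theorem weylDenominator_eq (t : Params) : t.weylDenominator = LaurentPolynomial.T 1 -
    (t.a⁻¹ + t.b⁻¹) • 1 + (t.a⁻¹ * t.b⁻¹) • LaurentPolynomial.T (-1) := by
  have h : (LaurentPolynomial.T (-1) * LaurentPolynomial.T 1 : Laurent) = 1 := by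
    rw [← LaurentPolynomial.T_add]; simp
  simp only [weylDenominator, LaurentPolynomial.smul_eq_C_mul, map_add, map_mul]
  linear_combination (LaurentPolynomial.T 1 - LaurentPolynomial.C t.a⁻¹ -
    LaurentPolynomial.C t.b⁻¹) * h

theorem coeff_T_mul (n k : ℤ) (f : Laurent) :
    (LaurentPolynomial.T n * f).coeff k = f.coeff (k - n) := by
  have h := AddMonoidAlgebra.coeff_single_mul_apply f (1 : ℂ) n k
  rwa [one_mul, neg_add_eq_sub] at h

theorem monicOfDegree_weylDenominator_mul (t : Params) {p : ℕ} {g : Laurent}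
    (hg : MonicOfDegree p g) : MonicOfDegree (p + 1 : ℕ) (t.weylDenominator * g) := by
  obtain ⟨h1, h2⟩ := monicOfDegree_natCast_iff.mp hg
  have hlarge : ∀ k : ℤ, k < -p ∨ (p : ℤ) < k → g.coeff k = 0 := by
    intro k hk
    refine h2 k ?_
    rw [← not_lt, position_lt_iff]
    omega
  have hc : ∀ k : ℤ, (t.weylDenominator * g).coeff k = g.coeff (k - 1) -
      (t.a⁻¹ + t.b⁻¹) * g.coeff k + (t.a⁻¹ * t.b⁻¹) * g.coeff (k + 1) := by
    intro k
    rw [weylDenominator_eq, add_mul, sub_mul, smul_mul_assoc, smul_mul_assoc, one_mul]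
    simp only [AddMonoidAlgebra.coeff_add, AddMonoidAlgebra.coeff_sub, AddMonoidAlgebra.coeff_smul,
      Finsupp.add_apply, Finsupp.sub_apply, Finsupp.smul_apply, smul_eq_mul, coeff_T_mul,
      sub_neg_eq_add]
  refine monicOfDegree_natCast_iff.mpr ⟨?_, fun k hk => ?_⟩
  · push_cast
    rw [hc, hlarge (p + 1) (by omega), hlarge (p + 1 + 1) (by omega), add_sub_cancel_right, h1]
    ring
  · rw [← not_lt, position_lt_iff] at hk
    push_cast at hk
    rw [hc, hlarge (k - 1) (by omega), hlarge k (by omega), hlarge (k + 1) (by omega)]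
    ring

theorem γ_shift (t : Params) (p : ℕ) : t.shift.γ p = t.γ (p + 1 : ℕ) := by
  have hq := t.q_ne
  rw [γ, γ, if_pos (by positivity), if_pos (by positivity)]
  change t.k0 * (t.q * t.k1) * t.q ^ (p : ℤ) = _
  push_cast
  rw [zpow_add_one₀ hq]
  ring

theorem isAntisymmetricAW_weylDenominator_mul (ht : t.Generic) {p : ℕ} {g : Laurent}
    (hg : t.shift.IsSymmetricAW p g) :
    t.IsAntisymmetricAW (p + 1) (t.weylDenominator * g) := by
  obtain ⟨h1, h2⟩ := hg
  rw [mem_map_Cplus ht.shift] at h1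
  have hsym : reflection 1 1 g = g :=
    reflection_eq_of_heckeOperator_eq one_ne_zero (by norm_num) t.shift.k1_ne h1.2
  refine ⟨(mem_map_Cminus ht).mpr ⟨mem_component_of_D ht (Nat.le_add_left 1 p) ?_,
    t.T1_weylDenominator_mul hsym⟩, monicOfDegree_weylDenominator_mul t h2⟩
  rw [D_weylDenominator_mul t hsym h1.2, D_of_mem_component ht.shift h1.1, γ_shift, mul_smul_comm]

theorem isAntisymmetricAW_unique (ht : t.Generic) {m : ℕ} {f g : Laurent}
    (hf : t.IsAntisymmetricAW m f) (hg : t.IsAntisymmetricAW m g) : f = g := by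
  obtain ⟨h1, h1'⟩ := hf
  obtain ⟨h2, h2'⟩ := hg
  rw [mem_map_Cminus ht] at h1 h2
  exact T1_eigenvector_unique ht h1.1 h1.2 h1' h2.1 h2.2 h2'

end Params

end

end AskeyWilson

/-- For `m ≥ 1` the polynomials `P_m⁻(x; t; q)` and `P_{m-1}⁺(x; k₀, q k₁, u₀, u₁; q)`, and the
non-symmetric polynomials by which they are defined, exist and are unique, and
`P_m⁻(x; t; q) = δ(x) P_{m-1}⁺(x; k₀, q k₁, u₀, u₁; q)`. -/
theorem proposition7p3 (t : AskeyWilson.Params) (ht : t.Generic) (m : ℕ) (hm : 1 ≤ m) :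
    (∀ n : ℤ, ∃! f : AskeyWilson.Laurent, t.IsNonsymmetricAW n f) ∧
    (∀ n : ℤ, ∃! f : AskeyWilson.Laurent, t.shift.IsNonsymmetricAW n f) ∧
    (∃! f : AskeyWilson.Laurent, t.IsAntisymmetricAW m f) ∧
    (∃! f : AskeyWilson.Laurent, t.shift.IsSymmetricAW (m - 1) f) ∧
    t.antisymmetricAW m = t.weylDenominator * t.shift.symmetricAW (m - 1) := by
  obtain ⟨p, rfl⟩ : ∃ p, m = p + 1 := ⟨m - 1, by omega⟩
  rw [Nat.add_sub_cancel]
  have hplus := AskeyWilson.Params.existsUnique_isSymmetricAW ht.shift p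
  -- The product with `δ` also supplies the existence of `P_m⁻`.
  have hminus := AskeyWilson.Params.isAntisymmetricAW_weylDenominator_mul ht
    (Classical.epsilon_spec hplus.exists)
  exact ⟨AskeyWilson.Params.existsUnique_isNonsymmetricAW ht,
    AskeyWilson.Params.existsUnique_isNonsymmetricAW ht.shift,
    ⟨_, hminus, fun f hf => AskeyWilson.Params.isAntisymmetricAW_unique ht hf hminus⟩, hplus,
    AskeyWilson.Params.isAntisymmetricAW_unique ht (Classical.epsilon_spec ⟨_, hminus⟩) hminus⟩
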